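/- Conventions. Let $R\subseteq A$ be rings (associative with $1$, sharing the same $1$) and $x_1,\dots,x_n\in A$. The ring $A$ is a skew PBW extension of $R$ in $x_1,\dots,x_n$ if (i) $A$ is a free left $R$-module with basis the monomials $x_1^{\alpha_1}\cdots x_n^{\alpha_n}$, $\alpha\in\mathbb{N}^n$; (ii) for all $1\le i\le n$ and $r\in R\setminus\{0\}$ there is $c_{i,r}\in R\setminus\{0\}$ with $x_ir-c_{i,r}x_i\in R$; (iii) for all $1\le i,j\le n$ there is $c_{i,j}\in R\setminus\{0\}$ with $x_jx_i-c_{i,j}x_ix_j\in R+Rx_1+\cdots+Rx_n$. Then there are unique maps $\sigma_i,\delta_i:R\to R$ with $x_ir=\sigma_i(r)x_i+\delta_i(r)$ for all $r\in R$; each $\sigma_i$ is a ring endomorphism and each $\delta_i$ is a $\sigma_i$-derivation, that is, $\delta_i$ is additive and $\delta_i(rs)=\sigma_i(r)\delta_i(s)+\delta_i(r)s$. Put $\Sigma=\{\sigma_1,\dots,\sigma_n\}$ and $\Delta=\{\delta_1,\dots,\delta_n\}$. The extension is bijective if every $\sigma_i$ is bijective and $c_{i,j}$ is invertible for all $1\le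 i<j\le n$. An ideal $I$ of $R$ is $(\Sigma,\Delta)$-invariant if $\sigma_i(I)\subseteq I$ and $\delta_i(I)\subseteq I$ for all $i$. A proper $(\Sigma,\Delta)$-invariant ideal $I$ is $(\Sigma,\Delta)$-prime if, for all $(\Sigma,\Delta)$-invariant ideals $J,K$ of $R$ with $JK\subseteq I$, one has $J\subseteq I$ or $K\subseteq I$. A proper two-sided ideal $P$ of $A$ is prime if, for all two-sided ideals $J,K$ of $A$ with $JK\subseteq P$, one has $J\subseteq P$ or $K\subseteq P$. An ideal of a commutative ring is semiprime if it equals its radical, and a commutative ring is semiprime if its zero ideal is semiprime, i.e. if it is reduced. $IA$ (respectively $AI$) denotes the set of finite sums of products $af$ (respectively $fa$) with $a\in I$ and $f\in A$. Theorem. Let $R$ be a commutative Noetherian semiprime ring, let $A$ be a bijective skew PBW extension of $R$ in $x_1,\dots,x_n$, with associated $\Sigma$ and $\Delta$, and let $I$ be a semiprime $(\Sigma,\Delta)$-invariant ideal of $R$. Then $I$ is a $(\Sigma,\Delta)$-prime ideal of $R$ if and only if $IA$ is a prime (two-sided) ideal of $A$. In that case $IA=AI$ and $IA\cap R=I$.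 -/

import Mathlib

namespace SkewPBW

section Ext

variable {R A : Type*} [Ring R] [Ring A] {n : ℕ}

/-- The standard monomial `x₁ ^ α₁ * ⋯ * xₙ ^ αₙ` (factors in this order). -/
def stdMonomial (x : Fin n → A) (α : Fin n → ℕ) : A :=
  (List.ofFn fun i => x i ^ α i).prod

/-- The relation `x_j x_i - c x_i x_j ∈ R + R x₁ + ⋯ + R xₙ`. -/
def CommRel (ι : R →+* A) (x : Fin n → A) (i j : Fin n) (c : R) : Prop :=
  ∃ (r₀ : R) (r : Fin n → R),
    x j * x i - ι c * (x i * x j) = ι r₀ + ∑ k, ι (r k) * x k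

/-- `A` is a skew PBW extension of `R` in the elements `x₁, …, xₙ`. The inclusion `R ⊆ A` is the
injective ring homomorphism `ι`. -/
structure IsSkewPBWExtension (ι : R →+* A) (x : Fin n → A) : Prop where
  injective : Function.Injective ι
  /-- The standard monomials form a basis of `A` as a left `R`-module. -/
  basis : ∀ f : A, ∃! c : (Fin n → ℕ) →₀ R, (c.sum fun α r => ι r * stdMonomial x α) = f
  exists_coeff : ∀ (i : Fin n) (r : R), r ≠ 0 → ∃ c : R, c ≠ 0 ∧ x i * ι r - ι c * x i ∈ ι.range
  exists_const : ∀ i j : Fin n, ∃ c : R, c ≠ 0 ∧ CommRel ι x i j c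

/-- A system of `n` endomorphisms `σ_i` of `R` and of `σ_i`-derivations `δ_i` of `R`. -/
structure SigmaDeltaSystem (R : Type*) [Ring R] (n : ℕ) where
  σ : Fin n → R →+* R
  δ : Fin n → R →+ R
  δ_mul : ∀ i r s, δ i (r * s) = σ i r * δ i s + δ i r * s

namespace IsSkewPBWExtension

variable {ι : R →+* A} {x : Fin n → A}

lemma exists_sigma_delta (h : IsSkewPBWExtension ι x) (i : Fin n) (r : R) :
    ∃ p : R × R, x i * ι r = ι p.1 * x i + ι p.2 := by
  by_cases hr : r = 0
  · exact ⟨(0, 0), by simp [hr]⟩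
  · obtain ⟨c, -, d, hd⟩ := h.exists_coeff i r hr
    exact ⟨(c, d), by rw [hd]; abel⟩

lemma stdMonomial_zero : stdMonomial x 0 = 1 := by
  simp [stdMonomial]

lemma stdMonomial_single (i : Fin n) : stdMonomial x (Pi.single i 1) = x i := by
  have key : ∀ (m : ℕ) (y : Fin m → A) (i : Fin m),
      (List.ofFn fun k => y k ^ (Pi.single i 1 : Fin m → ℕ) k).prod = y i := by
    intro m
    induction m with
    | zero => intro y i; exact i.elim0
    | succ m ih =>
      intro y i
      rw [List.ofFn_succ, List.prod_cons]
      refine Fin.cases ?_ (fun i' => ?_) i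
      · simp
      · have h2 := ih (fun k => y k.succ) i'
        rw [← h2]
        have h0 : (Pi.single (Fin.succ i') 1 : Fin (m + 1) → ℕ) 0 = 0 :=
          Pi.single_eq_of_ne (Fin.succ_ne_zero i').symm _
        rw [h0, pow_zero, one_mul]
        congr 2
        funext k
        congr 1
        simp [Pi.single_apply]
  exact key n x i

lemma pair_unique (h : IsSkewPBWExtension ι x) (i : Fin n) {a b a' b' : R}
    (e : ι a * x i + ι b = ι a' * x i + ι b') : a = a' ∧ b = b' := by
  classical
  have hne : (0 : Fin n → ℕ) ≠ Pi.single i 1 := by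
    intro hh
    have := congrFun hh i
    simp at this
  let s : R → R → ((Fin n → ℕ) →₀ R) := fun a b =>
    Finsupp.single (Pi.single i 1) a + Finsupp.single 0 b
  have hs : ∀ a b, ((s a b).sum fun α r => ι r * stdMonomial x α) = ι a * x i + ι b := by
    intro a b
    simp only [s]
    rw [Finsupp.sum_add_index' (by simp) (by intros; simp [add_mul]),
      Finsupp.sum_single_index (by simp), Finsupp.sum_single_index (by simp),
      stdMonomial_single, stdMonomial_zero, mul_one]
  have heq : s a b = s a' b' :=
    (h.basis (ι a' * x i + ι b')).unique ((hs a b).trans e) (hs a' b')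
  refine ⟨?_, ?_⟩
  · have := DFunLike.congr_fun heq (Pi.single i 1)
    simpa [s, Finsupp.single_apply, hne] using this
  · have := DFunLike.congr_fun heq 0
    simpa [s, Finsupp.single_apply, hne.symm] using this

/-- The maps `σ_i` of the extension, as plain functions. -/
noncomputable def sigmaFun (h : IsSkewPBWExtension ι x) (i : Fin n) (r : R) : R :=
  (h.exists_sigma_delta i r).choose.1

/-- The maps `δ_i` of the extension, as plain functions. -/
noncomputable def deltaFun (h : IsSkewPBWExtension ι x) (i : Fin n) (r : R) : R :=
  (h.exists_sigma_delta i r).choose.2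

lemma mul_eq (h : IsSkewPBWExtension ι x) (i : Fin n) (r : R) :
    x i * ι r = ι (h.sigmaFun i r) * x i + ι (h.deltaFun i r) :=
  (h.exists_sigma_delta i r).choose_spec

lemma fun_eq (h : IsSkewPBWExtension ι x) (i : Fin n) {r a b : R}
    (e : x i * ι r = ι a * x i + ι b) : h.sigmaFun i r = a ∧ h.deltaFun i r = b :=
  h.pair_unique i ((h.mul_eq i r).symm.trans e)

lemma fun_add (h : IsSkewPBWExtension ι x) (i : Fin n) (r s : R) :
    h.sigmaFun i (r + s) = h.sigmaFun i r + h.sigmaFun i s ∧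
      h.deltaFun i (r + s) = h.deltaFun i r + h.deltaFun i s := by
  apply h.fun_eq
  rw [map_add, mul_add, h.mul_eq i r, h.mul_eq i s, map_add, map_add, add_mul]
  abel

lemma fun_mul (h : IsSkewPBWExtension ι x) (i : Fin n) (r s : R) :
    h.sigmaFun i (r * s) = h.sigmaFun i r * h.sigmaFun i s ∧
      h.deltaFun i (r * s) = h.sigmaFun i r * h.deltaFun i s + h.deltaFun i r * s := by
  apply h.fun_eq
  rw [map_mul, ← mul_assoc, h.mul_eq i r, add_mul, mul_assoc, h.mul_eq i s, mul_add, map_mul,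
    map_add, map_mul, map_mul, ← mul_assoc, add_assoc]

/-- The system `(Σ, Δ)` of the extension: the unique maps with
`x_i r = σ_i(r) x_i + δ_i(r)` for all `r` in `R`. -/
noncomputable def system (h : IsSkewPBWExtension ι x) : SigmaDeltaSystem R n where
  σ i :=
    { toFun := h.sigmaFun i
      map_one' := (h.fun_eq i (r := 1) (a := 1) (b := 0) (by simp)).1
      map_mul' := fun r s => (h.fun_mul i r s).1
      map_zero' := (h.fun_eq i (r := 0) (a := 0) (b := 0) (by simp)).1
      map_add' := fun r s => (h.fun_add i r s).1 }
  δ i :=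
    { toFun := h.deltaFun i
      map_zero' := (h.fun_eq i (r := 0) (a := 0) (b := 0) (by simp)).2
      map_add' := fun r s => (h.fun_add i r s).2 }
  δ_mul i r s := (h.fun_mul i r s).2

lemma system_spec (h : IsSkewPBWExtension ι x) (i : Fin n) (r : R) :
    x i * ι r = ι (h.system.σ i r) * x i + ι (h.system.δ i r) :=
  h.mul_eq i r

/-- The extension is bijective: every `σ_i` is bijective and `c_{i,j}` is invertible for `i < j`.
For `i < j` the relation determines `c_{i,j}`, as the coefficient of `x_j x_i` at the standard
monomial `x_i x_j`. -/
def IsBijective (h : IsSkewPBWExtension ι x) : Prop :=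
  (∀ i, Function.Bijective (h.system.σ i)) ∧
    ∀ i j : Fin n, i < j → ∃ c : R, IsUnit c ∧ CommRel ι x i j c

end IsSkewPBWExtension

/-- `P` is a prime (two-sided) ideal of the possibly noncommutative ring `A`: it is proper, and if
a product `J K` of two ideals is contained in `P`, then so is one of them. -/
def IsPrimeIdeal (P : TwoSidedIdeal A) : Prop :=
  P ≠ ⊤ ∧ ∀ J K : TwoSidedIdeal A, (∀ a ∈ J, ∀ b ∈ K, a * b ∈ P) → J ≤ P ∨ K ≤ P

end Ext

section Ideals

variable {R A : Type*} [CommRing R] [Ring A] {n : ℕ}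

/-- `I` is `(Σ, Δ)`-invariant. -/
def IsInvariant (S : SigmaDeltaSystem R n) (I : Ideal R) : Prop :=
  (∀ i, ∀ r ∈ I, S.σ i r ∈ I) ∧ ∀ i, ∀ r ∈ I, S.δ i r ∈ I

/-- `I` is `(Σ, Δ)`-prime. -/
structure IsSigmaDeltaPrime (S : SigmaDeltaSystem R n) (I : Ideal R) : Prop where
  ne_top : I ≠ ⊤
  invariant : IsInvariant S I
  le_or_le : ∀ J K : Ideal R, IsInvariant S J → IsInvariant S K → J * K ≤ I → J ≤ I ∨ K ≤ I

/-- `IA`: the finite sums of products `a f` with `a` in `I` and `f` in `A`. -/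
def idealMul (ι : R →+* A) (I : Ideal R) : AddSubgroup A :=
  AddSubgroup.closure {g | ∃ a ∈ I, ∃ f : A, g = ι a * f}

/-- `AI`: the finite sums of products `f a` with `f` in `A` and `a` in `I`. -/
def mulIdeal (ι : R →+* A) (I : Ideal R) : AddSubgroup A :=
  AddSubgroup.closure {g | ∃ a ∈ I, ∃ f : A, g = f * ι a}

end Ideals

end SkewPBW

/-!
The ideal `I` is carried through the whole argument, so that no quotient of `R` or `A` is formed.
Since `A` is left free on the standard monomials, `IA` consists of the elements whose coefficients
all lie in `I`; hence `IA ∩ R = I`. Invariance of `I` gives `AI ⊆ IA`, and `σ_i(I) = I` (an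
automorphism of a Noetherian ring cannot map an ideal properly into itself,
`exists_preimage_mem`) gives `IA ⊆ AI`. If `J` and `K` are invariant with `JK ⊆ I`, then
`(JA)(KA) ⊆ IA`, so primeness of `IA` forces `I` to be `(Σ, Δ)`-prime.

The converse has two ingredients.

* A radical `(Σ, Δ)`-prime ideal `I` is `Σ`-prime (`IsSigmaDeltaPrime.mem_or_le`). If `cD ⊆ I` with
  `D` stable under `Σ`, the ideals `(I : D)` and `(I : (I : D))` have product in `I` and are stable
  under `Σ`. As `I` is radical and the `σ_i` restrict to bijections of these ideals, expanding
  `δ_i(s r) ∈ I` shows that they are stable under `Δ` as well.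
* Leading terms multiply up to units (`exists_isUnit_mul_word_mul`). Permuting the letters of a
  word in the `x_i` changes it by a unit of `R`, modulo `IA` and shorter words
  (`exists_isUnit_of_perm`). Let `f` and `g` lie outside `IA`, with `f A g ⊆ IA`. Modulo `I`, the
  exponents of the top degree parts of `f` and `g` form two finite subsets of `ℕⁿ`, and some sum of
  an exponent `α` of `f` and one of `g` is attained only once. The coefficients `c`, `d` there
  satisfy `c σ^α(σ_w(d)) ∈ I` for every word `w` (`exists_coeff_mul_mem`).

The ideal `D` generated by all `σ_w(d)` is stable under `Σ` and satisfies `σ^α(D) = D`, so `cD ⊆ I`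
although neither `c` nor `d` is in `I`, against `Σ`-primeness.
-/

namespace SkewPBW

/-! ### Ideals of the coefficient ring stable under automorphisms and skew derivations -/

section Ideals

variable {R : Type*} [CommRing R] {n : ℕ}

/-- A surjective endomorphism of a Noetherian ring that maps an ideal `D` into itself maps it onto
itself: the chain of the preimages of `D` under its iterates stabilizes. -/
lemma exists_preimage_mem [IsNoetherianRing R] {σ : R →+* R} (hσ : Function.Surjective σ)
    {D : Ideal R} (hD : ∀ r ∈ D, σ r ∈ D) {y : R} (hy : y ∈ D) : ∃ z ∈ D, σ z = y := by
  have hmem : ∀ k r, r ∈ D.comap (σ ^ k) ↔ (σ^[k]) r ∈ D := fun k r => by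
    rw [Ideal.mem_comap, RingHom.coe_pow]
  let F : ℕ →o Ideal R :=
    { toFun := fun k => D.comap (σ ^ k)
      monotone' := monotone_nat_of_le_succ fun k r hr => by
        rw [hmem] at hr ⊢
        rw [Function.iterate_succ_apply']
        exact hD _ hr }
  obtain ⟨k, hk⟩ := monotone_stabilizes_iff_noetherian.mpr ‹IsNoetherianRing R› F
  obtain ⟨z, rfl⟩ := hσ y
  obtain ⟨v, rfl⟩ := hσ.iterate k z
  refine ⟨_, ?_, rfl⟩
  have h1 : v ∈ F (k + 1) := by
    change v ∈ D.comap (σ ^ (k + 1))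
    rw [hmem, Function.iterate_succ_apply']
    exact hy
  rw [← hk (k + 1) (Nat.le_succ k)] at h1
  exact (hmem k v).1 h1

/-- If `J = (I : K)`, then `J` is stable under each `δ i`: for `r ∈ J` and `s ∈ K`, the square of
`σ i s * δ i r = δ i (s * r) - δ i s * r` lies in the radical ideal `I`. -/
lemma delta_mem_of_colon [IsNoetherianRing R] {S : SigmaDeltaSystem R n}
    (hσ : ∀ i, Function.Bijective (S.σ i)) {I J K : Ideal R} (hI : I.IsRadical)
    (hinv : IsInvariant S I) (hK : ∀ i, ∀ r ∈ K, S.σ i r ∈ K)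
    (hJK : ∀ r, r ∈ J ↔ ∀ y ∈ K, r * y ∈ I) (i : Fin n) {r : R} (hr : r ∈ J) : S.δ i r ∈ J := by
  rw [hJK]
  intro y hy
  obtain ⟨s, hs, rfl⟩ := exists_preimage_mem (hσ i).2 (hK i) hy
  have h1 : S.δ i (s * r) ∈ I := hinv.2 i _ (by rw [mul_comm]; exact (hJK r).1 hr s hs)
  have h2 : r * S.σ i s ∈ I := (hJK r).1 hr _ hy
  refine hI ⟨2, ?_⟩
  -- By the product rule, `σ(s) δ(r) = δ(s r) - δ(s) r`.
  have e : (S.δ i r * S.σ i s) ^ 2 = (S.δ i r * S.σ i s) * S.δ i (s * r) -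
      (S.δ i r * S.δ i s) * (r * S.σ i s) := by
    rw [S.δ_mul]; ring
  rw [e]
  exact I.sub_mem (I.mul_mem_left _ h1) (I.mul_mem_left _ h2)

/-- A radical `(Σ, Δ)`-prime ideal is already prime with respect to ideals stable under `Σ` only:
the ideals `(I : D)` and `(I : (I : D))` are `(Σ, Δ)`-invariant. -/
lemma IsSigmaDeltaPrime.mem_or_le [IsNoetherianRing R] {S : SigmaDeltaSystem R n} {I : Ideal R}
    (hp : IsSigmaDeltaPrime S I) (hσ : ∀ i, Function.Bijective (S.σ i)) (hI : I.IsRadical)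
    {D : Ideal R} (hD : ∀ i, ∀ r ∈ D, S.σ i r ∈ D) {c : R} (hc : ∀ y ∈ D, c * y ∈ I) :
    c ∈ I ∨ D ≤ I := by
  have colon_stable : ∀ {J K : Ideal R}, (∀ i, ∀ r ∈ K, S.σ i r ∈ K) →
      (∀ r, r ∈ J ↔ ∀ y ∈ K, r * y ∈ I) → ∀ i, ∀ r ∈ J, S.σ i r ∈ J := by
    intro J K hK hJK i r hr
    rw [hJK] at hr ⊢
    intro y hy
    obtain ⟨s, hs, rfl⟩ := exists_preimage_mem (hσ i).2 (hK i) hy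
    rw [← map_mul]
    exact hp.invariant.1 i _ (hr s hs)
  let colon : Ideal R → Ideal R := fun K =>
    { carrier := {r | ∀ y ∈ K, r * y ∈ I}
      add_mem' := fun ha hb y hy => by
        rw [add_mul]; exact I.add_mem (ha y hy) (hb y hy)
      zero_mem' := fun y _ => by rw [zero_mul]; exact I.zero_mem
      smul_mem' := fun t r hr y hy => by
        rw [smul_eq_mul, mul_assoc]; exact I.mul_mem_left _ (hr y hy) }
  have hcol : ∀ K r, r ∈ colon K ↔ ∀ y ∈ K, r * y ∈ I := fun _ _ => Iff.rfl
  have hle : D ≤ colon (colon D) := fun y hy r hr => by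
    rw [mul_comm]; exact hr y hy
  have htriple : ∀ r, r ∈ colon D ↔ ∀ y ∈ colon (colon D), r * y ∈ I :=
    fun r => ⟨fun hr y hy => by rw [mul_comm]; exact hy r hr, fun hr y hy => hr y (hle hy)⟩
  have hJσ := colon_stable hD (hcol D)
  have hKσ := colon_stable hJσ (hcol (colon D))
  have hJ : IsInvariant S (colon D) :=
    ⟨hJσ, fun i r hr => delta_mem_of_colon hσ hI hp.invariant hKσ htriple i hr⟩
  have hK : IsInvariant S (colon (colon D)) :=
    ⟨hKσ, fun i r hr => delta_mem_of_colon hσ hI hp.invariant hJσ (hcol _) i hr⟩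
  have hmul : colon D * colon (colon D) ≤ I :=
    Ideal.mul_le.2 fun r hr y hy => (htriple r).1 hr y hy
  exact (hp.le_or_le _ _ hJ hK hmul).imp (fun hle' => hle' hc) hle.trans

/-- The composite `σ_{i₁} ∘ ⋯ ∘ σ_{iₖ}` along the word `i₁ ⋯ iₖ`. -/
def SigmaDeltaSystem.wordσ (S : SigmaDeltaSystem R n) : List (Fin n) → R →+* R
  | [] => RingHom.id R
  | i :: w => (S.σ i).comp (S.wordσ w)

lemma SigmaDeltaSystem.wordσ_append (S : SigmaDeltaSystem R n) (v w : List (Fin n)) (r : R) :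
    S.wordσ (v ++ w) r = S.wordσ v (S.wordσ w r) := by
  induction v with
  | nil => rfl
  | cons i v ih => simp [wordσ, ih]

lemma SigmaDeltaSystem.exists_wordσ_eq [IsNoetherianRing R] {S : SigmaDeltaSystem R n}
    (hσ : ∀ i, Function.Bijective (S.σ i)) {D : Ideal R} (hD : ∀ i, ∀ r ∈ D, S.σ i r ∈ D)
    (w : List (Fin n)) {y : R} (hy : y ∈ D) : ∃ z ∈ D, S.wordσ w z = y := by
  induction w generalizing y with
  | nil => exact ⟨y, hy, rfl⟩
  | cons i w ih =>
    obtain ⟨z, hz, rfl⟩ := exists_preimage_mem (hσ i).2 (hD i) hy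
    obtain ⟨z', hz', rfl⟩ := ih hz
    exact ⟨z', hz', rfl⟩

end Ideals

/-! ### Words in the variables -/

section Words

variable {n : ℕ}

/-- The word `1 ⋯ 1 2 ⋯ 2 ⋯ n ⋯ n` in which the letter `i` occurs `α i` times. -/
def stdWord (α : Fin n → ℕ) : List (Fin n) :=
  (List.ofFn fun i => List.replicate (α i) i).flatten

lemma count_stdWord (α : Fin n → ℕ) (i : Fin n) : (stdWord α).count i = α i := by
  simp [stdWord, List.count_flatten, List.map_ofFn, List.sum_ofFn, List.count_replicate]

lemma length_stdWord (α : Fin n → ℕ) : (stdWord α).length = ∑ i, α i := by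
  simp [stdWord, List.length_flatten, List.map_ofFn, List.sum_ofFn]

lemma perm_stdWord {w : List (Fin n)} {α : Fin n → ℕ} (hw : ∀ i, w.count i = α i) :
    w.Perm (stdWord α) :=
  List.perm_iff_count.2 fun i => by rw [hw, count_stdWord]

lemma stdMonomial_eq_prod {A : Type*} [Ring A] (x : Fin n → A) (α : Fin n → ℕ) :
    stdMonomial x α = ((stdWord α).map x).prod := by
  simp [stdMonomial, stdWord, List.map_flatten, List.prod_flatten, List.map_ofFn,
    Function.comp_def]

end Words

/-! ### Coefficients, and the two-sided ideal generated by an invariant ideal -/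

section Ext

variable {R A : Type*} [CommRing R] [Ring A] {n : ℕ} {ι : R →+* A} {x : Fin n → A}

lemma mul_mem_idealMul {I : Ideal R} {a : R} (ha : a ∈ I) (f : A) : ι a * f ∈ idealMul ι I :=
  AddSubgroup.subset_closure ⟨a, ha, f, rfl⟩

lemma idealMul_le {I : Ideal R} {H : AddSubgroup A} (hH : ∀ a ∈ I, ∀ f, ι a * f ∈ H) :
    idealMul ι I ≤ H :=
  (AddSubgroup.closure_le _).2 fun _ ⟨a, ha, f, hg⟩ => hg ▸ hH a ha f

lemma mul_right_mem_idealMul {I : Ideal R} {g : A} (hg : g ∈ idealMul ι I) (f : A) :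
    g * f ∈ idealMul ι I := by
  refine idealMul_le (H := (idealMul ι I).comap (AddMonoidHom.mulRight f)) (fun a ha f' => ?_) hg
  change ι a * f' * f ∈ idealMul ι I
  rw [mul_assoc]
  exact mul_mem_idealMul ha _

namespace IsSkewPBWExtension

/-- The coefficients of an element of `A` in the basis of standard monomials. -/
noncomputable def coeff (h : IsSkewPBWExtension ι x) : A ≃+ ((Fin n → ℕ) →₀ R) :=
  (AddEquiv.ofBijective
    (Finsupp.liftAddHom fun α => (AddMonoidHom.mulRight (stdMonomial x α)).comp (ι : R →+ A))
    ⟨fun _ _ hc => (h.basis _).unique hc rfl, fun f => (h.basis f).exists⟩).symm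

lemma coeff_symm_apply (h : IsSkewPBWExtension ι x) (c : (Fin n → ℕ) →₀ R) :
    h.coeff.symm c = c.sum fun α r => ι r * stdMonomial x α := rfl

lemma sum_coeff (h : IsSkewPBWExtension ι x) (f : A) :
    ((h.coeff f).sum fun α r => ι r * stdMonomial x α) = f :=
  h.coeff.symm_apply_apply f

lemma coeff_mul_stdMonomial (h : IsSkewPBWExtension ι x) (r : R) (α : Fin n → ℕ) :
    h.coeff (ι r * stdMonomial x α) = Finsupp.single α r := by
  rw [← h.coeff.apply_symm_apply (Finsupp.single α r), coeff_symm_apply,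
    Finsupp.sum_single_index (by simp)]

lemma coeff_mul (h : IsSkewPBWExtension ι x) (r : R) (f : A) :
    h.coeff (ι r * f) = r • h.coeff f := by
  rw [← h.coeff.symm.injective.eq_iff, h.coeff.symm_apply_apply, coeff_symm_apply,
    Finsupp.sum_smul_index (by simp)]
  conv_lhs => rw [← h.sum_coeff f]
  simp [Finsupp.sum, Finset.mul_sum, mul_assoc]

lemma mem_of_words (h : IsSkewPBWExtension ι x) {H : AddSubgroup A}
    (hH : ∀ r (w : List (Fin n)), ι r * (w.map x).prod ∈ H) (f : A) : f ∈ H := by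
  rw [← h.sum_coeff f]
  exact H.sum_mem fun α _ => by
    beta_reduce
    rw [stdMonomial_eq_prod]
    exact hH _ _

lemma mem_idealMul_iff (h : IsSkewPBWExtension ι x) {I : Ideal R} {f : A} :
    f ∈ idealMul ι I ↔ ∀ α, h.coeff f α ∈ I := by
  constructor
  · let H : AddSubgroup A :=
      { carrier := {f | ∀ α, h.coeff f α ∈ I}
        add_mem' := fun ha hb α => by
          rw [map_add, Finsupp.add_apply]; exact I.add_mem (ha α) (hb α)
        zero_mem' := fun α => by rw [map_zero]; exact I.zero_mem
        neg_mem' := fun ha α => by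
          rw [map_neg, Finsupp.neg_apply]; exact I.neg_mem (ha α) }
    refine fun hf => idealMul_le (H := H) (fun a ha f α => ?_) hf
    rw [coeff_mul, Finsupp.smul_apply, smul_eq_mul]
    exact I.mul_mem_right _ ha
  · intro hf
    rw [← h.sum_coeff f]
    exact (idealMul ι I).sum_mem fun α _ => mul_mem_idealMul (hf α) _

lemma map_mem_idealMul_iff (h : IsSkewPBWExtension ι x) {I : Ideal R} {r : R} :
    ι r ∈ idealMul ι I ↔ r ∈ I := by
  refine ⟨fun hr => ?_, fun hr => by simpa using mul_mem_idealMul (ι := ι) hr 1⟩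
  have h0 := h.mem_idealMul_iff.1 hr 0
  rw [← mul_one (ι r), ← stdMonomial_zero (x := x), coeff_mul_stdMonomial] at h0
  simpa using h0

lemma mul_left_mem_idealMul (h : IsSkewPBWExtension ι x) {I : Ideal R}
    (hinv : IsInvariant h.system I) {g : A} (hg : g ∈ idealMul ι I) (f : A) :
    f * g ∈ idealMul ι I := by
  have hR : ∀ r, ∀ g ∈ idealMul ι I, ι r * g ∈ idealMul ι I := fun r g hg =>
    idealMul_le (H := (idealMul ι I).comap (AddMonoidHom.mulLeft (ι r))) (fun a ha f => by
      change ι r * (ι a * f) ∈ idealMul ι I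
      rw [← mul_assoc, ← map_mul]
      exact mul_mem_idealMul (I.mul_mem_left _ ha) _) hg
  have hx : ∀ i, ∀ g ∈ idealMul ι I, x i * g ∈ idealMul ι I := fun i g hg =>
    idealMul_le (H := (idealMul ι I).comap (AddMonoidHom.mulLeft (x i))) (fun a ha f => by
      change x i * (ι a * f) ∈ idealMul ι I
      rw [← mul_assoc, h.system_spec, add_mul, mul_assoc]
      exact add_mem (mul_mem_idealMul (hinv.1 i a ha) _) (mul_mem_idealMul (hinv.2 i a ha) _)) hg
  refine h.mem_of_words (H := (idealMul ι I).comap (AddMonoidHom.mulRight g)) (fun r w => ?_) f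
  change ι r * (w.map x).prod * g ∈ idealMul ι I
  rw [mul_assoc]
  refine hR r _ ?_
  induction w with
  | nil => simpa using hg
  | cons i w ih =>
    rw [List.map_cons, List.prod_cons, mul_assoc]
    exact hx i _ ih

/-- The additive group `IA` of an invariant ideal `I`, as a two-sided ideal of `A`. -/
def extend (h : IsSkewPBWExtension ι x) {I : Ideal R} (hinv : IsInvariant h.system I) :
    TwoSidedIdeal A :=
  TwoSidedIdeal.mk' (idealMul ι I) (zero_mem _) add_mem neg_mem
    (fun hg => h.mul_left_mem_idealMul hinv hg _) (fun hg => mul_right_mem_idealMul hg _)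

lemma coe_extend (h : IsSkewPBWExtension ι x) {I : Ideal R} (hinv : IsInvariant h.system I) :
    (h.extend hinv : Set A) = idealMul ι I :=
  TwoSidedIdeal.coe_mk' _ _ _ _ _ _

lemma mem_extend (h : IsSkewPBWExtension ι x) {I : Ideal R} (hinv : IsInvariant h.system I)
    {g : A} : g ∈ h.extend hinv ↔ g ∈ idealMul ι I :=
  Set.ext_iff.1 (h.coe_extend hinv) g

lemma idealMul_eq_mulIdeal [IsNoetherianRing R] (h : IsSkewPBWExtension ι x)
    (hσ : ∀ i, Function.Bijective (h.system.σ i)) {I : Ideal R}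
    (hinv : IsInvariant h.system I) : idealMul ι I = mulIdeal ι I := by
  have hmem : ∀ a ∈ I, ∀ f, f * ι a ∈ mulIdeal ι I := fun a ha f =>
    AddSubgroup.subset_closure ⟨a, ha, f, rfl⟩
  have hle : ∀ {H : AddSubgroup A}, (∀ a ∈ I, ∀ f, f * ι a ∈ H) → mulIdeal ι I ≤ H := fun hH =>
    (AddSubgroup.closure_le _).2 fun _ ⟨a, ha, f, hg⟩ => hg ▸ hH a ha f
  apply le_antisymm
  · have hx : ∀ i, ∀ g ∈ mulIdeal ι I, g * x i ∈ mulIdeal ι I := fun i g hg =>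
      hle (H := (mulIdeal ι I).comap (AddMonoidHom.mulRight (x i))) (fun a ha f => by
        change f * ι a * x i ∈ mulIdeal ι I
        -- `a = σ_i(b)` with `b ∈ I`, so `a x_i = x_i b - δ_i(b)`.
        obtain ⟨b, hb, rfl⟩ := exists_preimage_mem (hσ i).2 (hinv.1 i) ha
        have e : f * ι (h.system.σ i b) * x i = f * x i * ι b - f * ι (h.system.δ i b) := by
          rw [mul_assoc f (x i), h.system_spec, mul_add, mul_assoc]
          abel
        rw [e]
        exact sub_mem (hmem b hb _) (hmem _ (hinv.2 i b hb) _)) hg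
    have hw : ∀ w : List (Fin n), ∀ g ∈ mulIdeal ι I, g * (w.map x).prod ∈ mulIdeal ι I := by
      intro w
      induction w with
      | nil => intro g hg; simpa using hg
      | cons i w ih =>
        intro g hg
        rw [List.map_cons, List.prod_cons, ← mul_assoc]
        exact ih _ (hx i g hg)
    refine idealMul_le fun a ha f =>
      h.mem_of_words (H := (mulIdeal ι I).comap (AddMonoidHom.mulLeft (ι a))) (fun r w => ?_) f
    change ι a * (ι r * (w.map x).prod) ∈ mulIdeal ι I
    rw [← mul_assoc, ← map_mul]
    refine hw w _ ?_
    simpa using hmem _ (I.mul_mem_right r ha) 1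
  · exact hle fun a ha f =>
      h.mul_left_mem_idealMul hinv (by simpa using mul_mem_idealMul (ι := ι) ha 1) f

/-- If `J` and `K` are invariant with `J K ⊆ I`, then `(JA)(KA) ⊆ J(KA) ⊆ IA`; and `JA ⊆ IA` gives
`J ⊆ IA ∩ R = I`. -/
lemma isSigmaDeltaPrime_of_isPrimeIdeal (h : IsSkewPBWExtension ι x) {I : Ideal R}
    (hinv : IsInvariant h.system I) {P : TwoSidedIdeal A} (hP : (P : Set A) = idealMul ι I)
    (hprime : IsPrimeIdeal P) : IsSigmaDeltaPrime h.system I := by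
  have hmem : ∀ g, g ∈ P ↔ g ∈ idealMul ι I := Set.ext_iff.1 hP
  refine ⟨fun hI => hprime.1 ?_, hinv, fun J K hJ hK hJK => ?_⟩
  · refine eq_top_iff.2 fun g _ => (hmem g).2 ?_
    have := mul_mem_idealMul (ι := ι) (I := I) (a := 1) (by rw [hI]; trivial) g
    simpa using this
  · have hsub : ∀ {L : Ideal R} (hL : IsInvariant h.system L), h.extend hL ≤ P → L ≤ I :=
      fun hL hle r hr => h.map_mem_idealMul_iff.1 <| (hmem _).1 <| hle <|
        (h.mem_extend hL).2 <| h.map_mem_idealMul_iff.2 hr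
    refine (hprime.2 (h.extend hJ) (h.extend hK) fun a ha b hb => ?_).imp (hsub hJ) (hsub hK)
    rw [h.mem_extend] at ha hb
    rw [hmem]
    refine idealMul_le (H := (idealMul ι I).comap (AddMonoidHom.mulRight b))
      (fun a ha f => ?_) ha
    change ι a * f * b ∈ idealMul ι I
    rw [mul_assoc]
    refine idealMul_le (H := (idealMul ι I).comap (AddMonoidHom.mulLeft (ι a)))
      (fun c hc g => ?_) (h.mul_left_mem_idealMul hK hb f)
    change ι a * (ι c * g) ∈ idealMul ι I
    rw [← mul_assoc, ← map_mul]
    exact mul_mem_idealMul (hJK (Ideal.mul_mem_mul ha hc)) g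

end IsSkewPBWExtension

/-! ### The degree filtration modulo an invariant ideal -/

/-- `IA + F`, where `F` is the left `R`-span of all words in `x₁, …, xₙ` (in any order of the
letters) of length less than `m`. The bound is strict so that `m = 0` gives `IA` itself. -/
def degLT (ι : R →+* A) (x : Fin n → A) (I : Ideal R) (m : ℕ) : AddSubgroup A :=
  idealMul ι I ⊔ AddSubgroup.closure
    {g | ∃ (r : R) (w : List (Fin n)), w.length < m ∧ g = ι r * (w.map x).prod}

lemma degLT_le {I : Ideal R} {m : ℕ} {H : AddSubgroup A} (hI : idealMul ι I ≤ H)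
    (hH : ∀ r (w : List (Fin n)), w.length < m → ι r * (w.map x).prod ∈ H) :
    degLT ι x I m ≤ H :=
  sup_le hI ((AddSubgroup.closure_le _).2 fun _ ⟨r, w, hw, hg⟩ => hg ▸ hH r w hw)

lemma idealMul_le_degLT (I : Ideal R) (m : ℕ) : idealMul ι I ≤ degLT ι x I m := le_sup_left

lemma word_mem_degLT (I : Ideal R) {m : ℕ} (r : R) {w : List (Fin n)} (hw : w.length < m) :
    ι r * (w.map x).prod ∈ degLT ι x I m :=
  AddSubgroup.mem_sup_right (AddSubgroup.subset_closure ⟨r, w, hw, rfl⟩)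

lemma degLT_mono (I : Ideal R) {m k : ℕ} (hmk : m ≤ k) : degLT ι x I m ≤ degLT ι x I k :=
  degLT_le (idealMul_le_degLT I k) fun r _ hw => word_mem_degLT I r (hw.trans_le hmk)

namespace IsSkewPBWExtension

lemma mem_degLT_of_coeff (h : IsSkewPBWExtension ι x) {I : Ideal R} {m : ℕ} {f : A}
    (hf : ∀ α, m ≤ ∑ i, α i → h.coeff f α ∈ I) : f ∈ degLT ι x I m := by
  rw [← h.sum_coeff f]
  refine sum_mem fun α _ => ?_
  beta_reduce
  by_cases hα : m ≤ ∑ i, α i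
  · exact idealMul_le_degLT I m (mul_mem_idealMul (hf α hα) _)
  · rw [stdMonomial_eq_prod]
    exact word_mem_degLT I _ (by rw [length_stdWord]; omega)

variable {I : Ideal R}

lemma map_mul_mem_degLT (h : IsSkewPBWExtension ι x) (hinv : IsInvariant h.system I) {m : ℕ}
    (r : R) {g : A} (hg : g ∈ degLT ι x I m) : ι r * g ∈ degLT ι x I m := by
  refine degLT_le (H := (degLT ι x I m).comap (AddMonoidHom.mulLeft (ι r)))
    (fun f hf => idealMul_le_degLT I m (h.mul_left_mem_idealMul hinv hf _))
    (fun s w hw => ?_) hg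
  change ι r * (ι s * (w.map x).prod) ∈ degLT ι x I m
  rw [← mul_assoc, ← map_mul]
  exact word_mem_degLT I _ hw

lemma var_mul_mem_degLT (h : IsSkewPBWExtension ι x) (hinv : IsInvariant h.system I) {m : ℕ}
    (i : Fin n) {g : A} (hg : g ∈ degLT ι x I m) : x i * g ∈ degLT ι x I (m + 1) := by
  refine degLT_le (H := (degLT ι x I (m + 1)).comap (AddMonoidHom.mulLeft (x i)))
    (fun f hf => idealMul_le_degLT I _ (h.mul_left_mem_idealMul hinv hf _))
    (fun s w hw => ?_) hg
  change x i * (ι s * (w.map x).prod) ∈ degLT ι x I (m + 1)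
  rw [← mul_assoc, h.system_spec, add_mul, mul_assoc]
  exact add_mem (word_mem_degLT (w := i :: w) I _ (by simpa using hw))
    (word_mem_degLT I _ (by omega))

lemma word_mul_mem_degLT (h : IsSkewPBWExtension ι x) (hinv : IsInvariant h.system I) {m : ℕ}
    (w : List (Fin n)) {g : A} (hg : g ∈ degLT ι x I m) :
    (w.map x).prod * g ∈ degLT ι x I (w.length + m) := by
  induction w with
  | nil => simpa using hg
  | cons i w ih =>
    rw [List.map_cons, List.prod_cons, mul_assoc, List.length_cons, add_right_comm]
    exact h.var_mul_mem_degLT hinv i ih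

lemma mul_mem_degLT (h : IsSkewPBWExtension ι x) (hinv : IsInvariant h.system I) {m k : ℕ}
    {f g : A} (hf : f ∈ degLT ι x I (m + 1)) (hg : g ∈ degLT ι x I k) :
    f * g ∈ degLT ι x I (m + k) := by
  refine degLT_le (H := (degLT ι x I (m + k)).comap (AddMonoidHom.mulRight g))
    (fun f hf => idealMul_le_degLT I _ (mul_right_mem_idealMul hf _)) (fun r w hw => ?_) hf
  change ι r * (w.map x).prod * g ∈ degLT ι x I (m + k)
  rw [mul_assoc]
  exact h.map_mul_mem_degLT hinv r
    (degLT_mono I (by omega) (h.word_mul_mem_degLT hinv w hg))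

/-- The companion of `mul_mem_degLT` with the strict degree bound on the left factor. It is not a
reindexing of that lemma for `m = 0`, where it says that `IA` is a right ideal. -/
lemma mul_mem_degLT' (h : IsSkewPBWExtension ι x) (hinv : IsInvariant h.system I) {m k : ℕ}
    {f g : A} (hf : f ∈ degLT ι x I m) (hg : g ∈ degLT ι x I (k + 1)) :
    f * g ∈ degLT ι x I (m + k) := by
  cases m with
  | zero =>
    refine degLT_le (H := (degLT ι x I (0 + k)).comap (AddMonoidHom.mulRight g))
      (fun f hf => idealMul_le_degLT I _ (mul_right_mem_idealMul hf _)) (fun r w hw => ?_) hf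
    exact absurd hw (Nat.not_lt_zero _)
  | succ m =>
    rw [add_assoc, add_comm 1 k]
    exact h.mul_mem_degLT hinv hf hg

/-- Modulo lower terms, moving a coefficient `r` to the left past the word `w` turns it into
`σ_w(r)`. -/
lemma word_mul_map_sub_mem (h : IsSkewPBWExtension ι x) (hinv : IsInvariant h.system I)
    (w : List (Fin n)) (r : R) :
    (w.map x).prod * ι r - ι (h.system.wordσ w r) * (w.map x).prod ∈
      degLT ι x I w.length := by
  induction w with
  | nil => simp [SigmaDeltaSystem.wordσ]
  | cons i w ih =>
    have e : ((i :: w).map x).prod * ι r -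
        ι (h.system.wordσ (i :: w) r) * ((i :: w).map x).prod =
        x i * ((w.map x).prod * ι r - ι (h.system.wordσ w r) * (w.map x).prod) +
          ι (h.system.δ i (h.system.wordσ w r)) * (w.map x).prod := by
      have := h.system_spec i (h.system.wordσ w r)
      rw [mul_sub, ← mul_assoc (x i) (ι _), this]
      simp only [List.map_cons, List.prod_cons, SigmaDeltaSystem.wordσ, RingHom.comp_apply,
        add_mul, mul_assoc]
      abel
    rw [e, List.length_cons]
    exact add_mem (h.var_mul_mem_degLT hinv i ih) (word_mem_degLT I _ (Nat.lt_succ_self _))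

/-- For a bijective extension, all the constants `c_{i,j}` may be taken to be units. -/
lemma exists_isUnit_commRel (h : IsSkewPBWExtension ι x) (hbij : h.IsBijective) (i j : Fin n) :
    ∃ c : R, IsUnit c ∧ CommRel ι x i j c := by
  rcases lt_trichotomy i j with hij | rfl | hij
  · exact hbij.2 i j hij
  · exact ⟨1, isUnit_one, 0, 0, by simp⟩
  · obtain ⟨c, ⟨u, rfl⟩, r₀, r, hr⟩ := hbij.2 j i hij
    refine ⟨↑u⁻¹, Units.isUnit _, -(↑u⁻¹ * r₀), fun k => -(↑u⁻¹ * r k), ?_⟩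
    have hu : ι (↑u⁻¹ : R) * ι (u : R) = 1 := by rw [← map_mul]; simp
    calc x j * x i - ι ↑u⁻¹ * (x i * x j)
        = -(ι ↑u⁻¹ * (x i * x j - ι (u : R) * (x j * x i))) := by
          rw [mul_sub, ← mul_assoc (ι _) (ι _), hu, one_mul]; abel
      _ = _ := by
          rw [hr, mul_add, Finset.mul_sum]
          simp only [map_neg, map_mul, neg_mul, Finset.sum_neg_distrib, neg_add, mul_assoc]

/-- Permuting the letters of a word only changes it by a unit coefficient, modulo words of smaller
length. -/
lemma exists_isUnit_of_perm (h : IsSkewPBWExtension ι x) (hbij : h.IsBijective)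
    (hinv : IsInvariant h.system I) {v w : List (Fin n)} (hvw : v.Perm w) :
    ∃ u : R, IsUnit u ∧ (v.map x).prod - ι u * (w.map x).prod ∈ degLT ι x I v.length := by
  induction hvw with
  | nil => exact ⟨1, isUnit_one, by simp⟩
  | @cons i v w _ ih =>
    obtain ⟨u, hu, hmem⟩ := ih
    refine ⟨h.system.σ i u, hu.map _, ?_⟩
    have e : ((i :: v).map x).prod - ι (h.system.σ i u) * ((i :: w).map x).prod =
        x i * ((v.map x).prod - ι u * (w.map x).prod) +
          ι (h.system.δ i u) * (w.map x).prod := by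
      rw [mul_sub, ← mul_assoc (x i) (ι _), h.system_spec]
      simp only [List.map_cons, List.prod_cons, add_mul, mul_assoc]
      abel
    rw [e, List.length_cons]
    refine add_mem (h.var_mul_mem_degLT hinv i hmem) (word_mem_degLT I _ ?_)
    have := List.Perm.length_eq ‹_›
    omega
  | swap i j l =>
    obtain ⟨u, hu, r₀, r, hr⟩ := h.exists_isUnit_commRel hbij i j
    refine ⟨u, hu, ?_⟩
    have e : ((j :: i :: l).map x).prod - ι u * ((i :: j :: l).map x).prod =
        ι r₀ * (l.map x).prod + ∑ k, ι (r k) * ((k :: l).map x).prod := by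
      have := congrArg (· * (l.map x).prod) hr
      simp only [sub_mul, add_mul, Finset.sum_mul, mul_assoc] at this
      simpa only [List.map_cons, List.prod_cons] using this
    rw [e]
    exact add_mem (word_mem_degLT I _ (by simp))
      (sum_mem fun k _ => word_mem_degLT I _ (by simp))
  | @trans v w z hvw _ ih₁ ih₂ =>
    obtain ⟨u₁, hu₁, h₁⟩ := ih₁
    obtain ⟨u₂, hu₂, h₂⟩ := ih₂
    refine ⟨u₁ * u₂, hu₁.mul hu₂, ?_⟩
    have e : (v.map x).prod - ι (u₁ * u₂) * (z.map x).prod =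
        ((v.map x).prod - ι u₁ * (w.map x).prod) +
          ι u₁ * ((w.map x).prod - ι u₂ * (z.map x).prod) := by
      rw [mul_sub, map_mul, mul_assoc]; abel
    rw [e]
    rw [← hvw.length_eq] at h₂
    exact add_mem h₁ (h.map_mul_mem_degLT hinv _ h₂)

/-- Elements of filtration degree less than `m` have their coefficients of total degree at least
`m` in `I`; so the filtration by words is the filtration by standard monomials. -/
lemma coeff_mem_of_mem_degLT (h : IsSkewPBWExtension ι x) (hbij : h.IsBijective)
    (hinv : IsInvariant h.system I) {m : ℕ} {f : A} (hf : f ∈ degLT ι x I m)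
    {α : Fin n → ℕ} (hα : m ≤ ∑ i, α i) : h.coeff f α ∈ I := by
  induction m generalizing f α with
  | zero =>
    refine h.mem_idealMul_iff.1 (degLT_le le_rfl (fun r w hw => ?_) hf) α
    exact absurd hw (Nat.not_lt_zero _)
  | succ m ih =>
    let H : AddSubgroup A :=
      I.toAddSubgroup.comap ((Finsupp.applyAddHom α).comp h.coeff.toAddMonoidHom)
    refine degLT_le (H := H) (fun g hg => h.mem_idealMul_iff.1 hg α) (fun r w hw => ?_) hf
    change h.coeff (ι r * (w.map x).prod) α ∈ I
    obtain ⟨u, -, hmem⟩ := h.exists_isUnit_of_perm hbij hinv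
      (perm_stdWord (w := w) fun _ => rfl)
    have hlen : ∑ i, w.count i = w.length := by
      rw [← length_stdWord, ← (perm_stdWord (w := w) fun _ => rfl).length_eq]
    rw [← stdMonomial_eq_prod] at hmem
    have hne : (fun i => w.count i) ≠ α := by
      rintro rfl
      exact absurd hα (by rw [hlen]; omega)
    have h1 := ih (degLT_mono I (by omega) hmem) (α := α) (by omega)
    rw [map_sub, Finsupp.sub_apply, coeff_mul_stdMonomial, Finsupp.single_eq_of_ne' hne,
      sub_zero] at h1
    rw [coeff_mul, Finsupp.smul_apply, smul_eq_mul]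
    exact I.mul_mem_left _ h1

/-! ### Leading terms and primeness -/

/-- The leading part of `f` modulo `I`: `m` is the largest total degree of an exponent whose
coefficient is outside `I`, and `T` is the set of all such exponents of degree `m`. -/
lemma exists_leading_part (h : IsSkewPBWExtension ι x) {f : A} (hf : f ∉ idealMul ι I) :
    ∃ (m : ℕ) (T : Finset (Fin n → ℕ)), T.Nonempty ∧
      (∀ α ∈ T, ∑ i, α i = m ∧ h.coeff f α ∉ I) ∧
      f - ∑ α ∈ T, ι (h.coeff f α) * stdMonomial x α ∈ degLT ι x I m := by
  classical
  let B := (h.coeff f).support.filter fun α => h.coeff f α ∉ I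
  have hB : ∀ α, α ∈ B ↔ h.coeff f α ∉ I := fun α => by
    simp only [B, Finset.mem_filter, Finsupp.mem_support_iff, and_iff_right_iff_imp]
    intro hα h0
    exact hα (h0 ▸ I.zero_mem)
  have hne : B.Nonempty := by
    by_contra hem
    rw [Finset.not_nonempty_iff_eq_empty] at hem
    refine hf (h.mem_idealMul_iff.2 fun α => ?_)
    by_contra hα
    simpa [hem] using (hB α).2 hα
  obtain ⟨α₀, hα₀, hmax⟩ := B.exists_max_image (fun α => ∑ i, α i) hne
  let T := B.filter fun α => ∑ i, α i = ∑ i, α₀ i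
  have hT : ∀ α, α ∈ T ↔ α ∈ B ∧ ∑ i, α i = ∑ i, α₀ i := fun α => Finset.mem_filter
  refine ⟨∑ i, α₀ i, T, ⟨α₀, (hT _).2 ⟨hα₀, rfl⟩⟩,
    fun α hα => ⟨((hT α).1 hα).2, (hB α).1 ((hT α).1 hα).1⟩,
    h.mem_degLT_of_coeff fun β hβ => ?_⟩
  rw [map_sub, map_sum, Finsupp.sub_apply, Finsupp.finsetSum_apply]
  simp only [coeff_mul_stdMonomial]
  by_cases hβT : β ∈ T
  · rw [Finset.sum_eq_single_of_mem β hβT fun α _ hαβ => Finsupp.single_eq_of_ne' hαβ]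
    simp
  · rw [Finset.sum_eq_zero fun α hα => Finsupp.single_eq_of_ne' (ne_of_mem_of_not_mem hα hβT),
      sub_zero]
    by_contra hβI
    have hβB := (hB β).2 hβI
    exact hβT ((hT β).2 ⟨hβB, le_antisymm (hmax β hβB) hβ⟩)

/-- Modulo lower terms, `c x^α · x_w · d x^β` is a unit times
`c σ^α(σ_w(d)) x^(α + γ + β)`, where `γ` counts the letters of `w`. -/
lemma exists_isUnit_mul_word_mul (h : IsSkewPBWExtension ι x) (hbij : h.IsBijective)
    (hinv : IsInvariant h.system I) (c d : R) (α β : Fin n → ℕ) (w : List (Fin n)) :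
    ∃ u : R, IsUnit u ∧
      ι c * stdMonomial x α * (w.map x).prod * (ι d * stdMonomial x β) -
        ι (c * h.system.wordσ (stdWord α) (h.system.wordσ w d) * u) *
          stdMonomial x (α + (fun i => w.count i) + β) ∈
        degLT ι x I (∑ i, α i + w.length + ∑ i, β i) := by
  set v := stdWord α ++ w
  have hv : v.length = ∑ i, α i + w.length := by simp [v, length_stdWord]
  have hperm : (v ++ stdWord β).Perm (stdWord (α + (fun i => w.count i) + β)) :=
    perm_stdWord fun i => by simp [v, count_stdWord, add_assoc]
  obtain ⟨u, hu, hmem⟩ := h.exists_isUnit_of_perm hbij hinv hperm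
  refine ⟨u, hu, ?_⟩
  have h1 := h.mul_mem_degLT' hinv (h.word_mul_map_sub_mem hinv v d)
    (k := ∑ i, β i) (g := stdMonomial x β) (by
      rw [stdMonomial_eq_prod, ← one_mul (List.prod _), ← map_one ι]
      exact word_mem_degLT I _ (by rw [length_stdWord]; omega))
  have h2 := h.map_mul_mem_degLT hinv (h.system.wordσ v d) hmem
  rw [List.length_append, length_stdWord] at h2
  rw [← hv]
  have e : ι c * stdMonomial x α * (w.map x).prod * (ι d * stdMonomial x β) -
      ι (c * h.system.wordσ (stdWord α) (h.system.wordσ w d) * u) *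
        stdMonomial x (α + (fun i => w.count i) + β) =
      ι c * (((v.map x).prod * ι d - ι (h.system.wordσ v d) * (v.map x).prod) *
        stdMonomial x β + ι (h.system.wordσ v d) * (((v ++ stdWord β).map x).prod -
          ι u * ((stdWord (α + (fun i => w.count i) + β)).map x).prod)) := by
    rw [← h.system.wordσ_append]
    simp only [stdMonomial_eq_prod, v, List.map_append, List.prod_append, map_mul, mul_add,
      mul_sub, sub_mul, mul_assoc]
    abel
  rw [e]
  exact h.map_mul_mem_degLT hinv c (add_mem h1 h2)

/-- If `f x_w g ∈ IA` for all words `w`, with `f` and `g` outside `IA`, there are `c, d ∉ I` and an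
exponent `α` with `c σ^α(σ_w(d)) ∈ I` for all words `w`. -/
lemma exists_coeff_mul_mem (h : IsSkewPBWExtension ι x) (hbij : h.IsBijective)
    (hinv : IsInvariant h.system I) {f g : A} (hf : f ∉ idealMul ι I) (hg : g ∉ idealMul ι I)
    (hfg : ∀ w : List (Fin n), f * (w.map x).prod * g ∈ idealMul ι I) :
    ∃ (c d : R) (α : Fin n → ℕ), c ∉ I ∧ d ∉ I ∧
      ∀ w, c * h.system.wordσ (stdWord α) (h.system.wordσ w d) ∈ I := by
  obtain ⟨m, T, hTne, hT, hfT⟩ := h.exists_leading_part hf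
  obtain ⟨k, U, hUne, hU, hgU⟩ := h.exists_leading_part hg
  -- A pair whose sum is attained only once yields a coefficient without cancellation.
  obtain ⟨α₀, hα₀, β₀, hβ₀, huniq⟩ := UniqueSums.uniqueAdd_of_nonempty hTne hUne
  refine ⟨h.coeff f α₀, h.coeff g β₀, α₀, (hT _ hα₀).2, (hU _ hβ₀).2, fun w => ?_⟩
  choose u hu hmem using fun α β => h.exists_isUnit_mul_word_mul hbij hinv
    (h.coeff f α) (h.coeff g β) α β w
  set γ : Fin n → ℕ := fun i => w.count i
  set C : (Fin n → ℕ) → (Fin n → ℕ) → R := fun α β =>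
    h.coeff f α * h.system.wordσ (stdWord α) (h.system.wordσ w (h.coeff g β))
  have hγ : ∑ i, γ i = w.length := by
    rw [← length_stdWord, ← (perm_stdWord (w := w) fun _ => rfl).length_eq]
  have mem_top : ∀ (e : A) (V : Finset (Fin n → ℕ)) (l : ℕ),
      (∀ α ∈ V, ∑ i, α i = l ∧ h.coeff e α ∉ I) →
      ∑ α ∈ V, ι (h.coeff e α) * stdMonomial x α ∈ degLT ι x I (l + 1) := fun e V l hV =>
    sum_mem fun α hα => by
      rw [stdMonomial_eq_prod]
      exact word_mem_degLT I _ (by rw [length_stdWord, (hV α hα).1]; omega)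
  have hw : (w.map x).prod ∈ degLT ι x I (w.length + 1) := by
    simpa using word_mem_degLT (ι := ι) (x := x) I 1 (Nat.lt_succ_self w.length)
  have hgtop : g ∈ degLT ι x I (k + 1) := by
    rw [← sub_add_cancel g (∑ β ∈ U, ι (h.coeff g β) * stdMonomial x β)]
    exact add_mem (degLT_mono I (Nat.le_succ k) hgU) (mem_top g U k hU)
  set f₀ := ∑ α ∈ T, ι (h.coeff f α) * stdMonomial x α
  set g₀ := ∑ β ∈ U, ι (h.coeff g β) * stdMonomial x β
  have hsum : f₀ * (w.map x).prod * g₀ - ∑ α ∈ T, ∑ β ∈ U,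
      ι (C α β * u α β) * stdMonomial x (α + γ + β) ∈ degLT ι x I (m + w.length + k) := by
    simp only [f₀, g₀]
    rw [Finset.sum_mul, Finset.sum_mul_sum, ← Finset.sum_sub_distrib]
    refine sum_mem fun α hα => ?_
    rw [← Finset.sum_sub_distrib]
    refine sum_mem fun β hβ => ?_
    have := hmem α β
    rwa [(hT α hα).1, (hU β hβ).1] at this
  have htotal : ∑ α ∈ T, ∑ β ∈ U, ι (C α β * u α β) * stdMonomial x (α + γ + β) ∈
      degLT ι x I (m + w.length + k) := by
    have e : ∑ α ∈ T, ∑ β ∈ U, ι (C α β * u α β) * stdMonomial x (α + γ + β) =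
        f * (w.map x).prod * g - (f - f₀) * (w.map x).prod * g -
          f₀ * (w.map x).prod * (g - g₀) - (f₀ * (w.map x).prod * g₀ -
          ∑ α ∈ T, ∑ β ∈ U, ι (C α β * u α β) * stdMonomial x (α + γ + β)) := by
      noncomm_ring
    rw [e]
    refine sub_mem (sub_mem (sub_mem ?_ ?_) ?_) hsum
    · exact idealMul_le_degLT I _ (hfg w)
    · exact h.mul_mem_degLT' hinv (h.mul_mem_degLT' hinv hfT hw) hgtop
    · refine h.mul_mem_degLT hinv ?_ hgU
      exact h.mul_mem_degLT hinv (k := w.length + 1) (mem_top f T m hT) hw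
  have hcoeff := h.coeff_mem_of_mem_degLT hbij hinv htotal (α := α₀ + γ + β₀) (by
    simp only [Pi.add_apply, Finset.sum_add_distrib, hγ, (hT _ hα₀).1, (hU _ hβ₀).1]
    exact le_rfl)
  have hne : ∀ α ∈ T, ∀ β ∈ U, ¬ (α = α₀ ∧ β = β₀) → α + γ + β ≠ α₀ + γ + β₀ := by
    intro α hα β hβ hn e
    refine hn (huniq hα hβ (add_right_cancel (b := γ) ?_))
    rw [add_right_comm, e, add_right_comm]
  rw [map_sum, Finsupp.finsetSum_apply, Finset.sum_eq_single_of_mem α₀ hα₀, map_sum,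
    Finsupp.finsetSum_apply, Finset.sum_eq_single_of_mem β₀ hβ₀, coeff_mul_stdMonomial,
    Finsupp.single_eq_same] at hcoeff
  · exact (Ideal.mul_unit_mem_iff_mem I (hu α₀ β₀)).1 hcoeff
  · intro β hβ hβne
    rw [coeff_mul_stdMonomial]
    exact Finsupp.single_eq_of_ne' (hne α₀ hα₀ β hβ fun hh => hβne hh.2)
  · intro α hα hαne
    rw [map_sum, Finsupp.finsetSum_apply]
    refine Finset.sum_eq_zero fun β hβ => ?_
    rw [coeff_mul_stdMonomial]
    exact Finsupp.single_eq_of_ne' (hne α hα β hβ fun hh => hαne hh.1)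

lemma isPrimeIdeal_extend [IsNoetherianRing R] (h : IsSkewPBWExtension ι x)
    (hbij : h.IsBijective) (hI : I.IsRadical) (hp : IsSigmaDeltaPrime h.system I) :
    IsPrimeIdeal (h.extend hp.invariant) := by
  have hinv := hp.invariant
  refine ⟨fun htop => hp.ne_top ?_, fun J K hJK => ?_⟩
  · rw [Ideal.eq_top_iff_one, ← h.map_mem_idealMul_iff (I := I), ← h.mem_extend hinv, htop]
    trivial
  · by_contra! hcon
    obtain ⟨f, hfJ, hf⟩ := Set.not_subset.1 hcon.1
    obtain ⟨g, hgK, hg⟩ := Set.not_subset.1 hcon.2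
    obtain ⟨c, d, α, hc, hd, hcd⟩ := h.exists_coeff_mul_mem hbij hinv
      (fun hh => hf ((h.mem_extend hinv).2 hh)) (fun hh => hg ((h.mem_extend hinv).2 hh))
      fun w => (h.mem_extend hinv).1 (hJK _ (J.mul_mem_right _ _ hfJ) _ hgK)
    -- The smallest `Σ`-stable ideal containing `d`.
    let D : Ideal R := Ideal.span (Set.range fun w => h.system.wordσ w d)
    have hD : ∀ i, ∀ r ∈ D, h.system.σ i r ∈ D := by
      intro i
      change D ≤ D.comap (h.system.σ i)
      refine Ideal.span_le.2 ?_
      rintro _ ⟨w, rfl⟩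
      exact Ideal.subset_span ⟨i :: w, rfl⟩
    have hcD : D ≤ Ideal.comap (h.system.wordσ (stdWord α)) (I.colon {c}) := by
      refine Ideal.span_le.2 ?_
      rintro _ ⟨w, rfl⟩
      simpa [Submodule.mem_colon_singleton, mul_comm] using hcd w
    -- Every element of `D` is `σ^α` of an element of `D`, so `c D ⊆ I`.
    rcases hp.mem_or_le hbij.1 hI hD (c := c) (fun y hy => by
      obtain ⟨z, hz, rfl⟩ := SigmaDeltaSystem.exists_wordσ_eq hbij.1 hD (stdWord α) hy
      simpa [Submodule.mem_colon_singleton, mul_comm] using hcD hz) with hcI | hDI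
    · exact hc hcI
    · exact hd (hDI (Ideal.subset_span ⟨[], rfl⟩))

end IsSkewPBWExtension

end Ext

end SkewPBW

theorem theorem5p7 {R A : Type*} [CommRing R] [IsNoetherianRing R] [IsReduced R] [Ring A] {n : ℕ}
    (ι : R →+* A) (x : Fin n → A) (h : SkewPBW.IsSkewPBWExtension ι x) (hbij : h.IsBijective)
    (I : Ideal R) (hI : I.IsRadical) (hinv : SkewPBW.IsInvariant h.system I) :
    (SkewPBW.IsSigmaDeltaPrime h.system I ↔
      ∃ P : TwoSidedIdeal A, (P : Set A) = SkewPBW.idealMul ι I ∧ SkewPBW.IsPrimeIdeal P) ∧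
    (SkewPBW.IsSigmaDeltaPrime h.system I →
      SkewPBW.idealMul ι I = SkewPBW.mulIdeal ι I ∧
      ∀ r : R, ι r ∈ SkewPBW.idealMul ι I ↔ r ∈ I) := by
  refine ⟨⟨fun hp => ⟨h.extend hinv, h.coe_extend hinv, h.isPrimeIdeal_extend hbij hI hp⟩, ?_⟩,
    fun _ => ⟨h.idealMul_eq_mulIdeal hbij.1 hinv, fun _ => h.map_mem_idealMul_iff⟩⟩
  rintro ⟨P, hP, hprime⟩
  exact h.isSigmaDeltaPrime_of_isPrimeIdeal hinv hP hprime
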